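/- Let $\mathcal A$ be a (locally small) accessible category with all small directed colimits, and let $\mathsf S(\mathcal A)=\mathrm{Acc}_\omega(\mathcal A,\mathbf{Set})$ be the category of functors $\mathcal A\to\mathbf{Set}$ preserving small directed colimits, with natural transformations as morphisms. Then $\mathsf S(\mathcal A)$ is a Grothendieck topos, i.e. it is equivalent to the category of sheaves of sets on a small site. Moreover, let $\lambda$ be any regular cardinal for which $\mathcal A$ is $\lambda$-accessible, and let $\mathcal A_\lambda\subseteq\mathcal A$ be the full subcategory of $\lambda$-presentable objects. Then the restriction functor $i:\mathsf S(\mathcal A)\to\mathbf{Set}^{\mathcal A_\lambda}$, $F\mapsto F|_{\mathcal A_\lambda}$, is fully faithful and has a right adjoint $r$, so that $\mathsf S(\mathcal A)$ is (up to equivalence) a coreflective subcategory of $\mathbf{Set}^{\mathcal A_\lambda}$, and the associated comonad $i\,r$ on $\mathbf{Set}^{\mathcal A_\lambda}$ preserves finite limits. -/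

import Mathlib

open CategoryTheory CategoryTheory.Limits

universe w v u v' u'

namespace Scott

/-- `A` has (`w`-small) directed colimits: every diagram indexed by a `w`-small nonempty directed
partially ordered set has a colimit. -/
class HasDirectedColimits (A : Type u) [Category.{v} A] : Prop where
  hasColimitsOfShape (I : Type w) [PartialOrder I] [IsDirectedOrder I] [Nonempty I] :
    HasColimitsOfShape I A

/-- `F` preserves (`w`-small) directed colimits, that is, colimits of diagrams indexed by a
`w`-small nonempty directed partially ordered set. -/
class PreservesDirectedColimits {A : Type u} [Category.{v} A] {B : Type u'} [Category.{v'} B]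
    (F : A ⥤ B) : Prop where
  preservesColimitsOfShape (I : Type w) [PartialOrder I] [IsDirectedOrder I] [Nonempty I] :
    PreservesColimitsOfShape I F

/-- The property of a functor `A ⥤ Type w` of preserving `w`-small directed colimits. -/
def preservesDirectedColimits (A : Type u) [Category.{v} A] : ObjectProperty (A ⥤ Type w) :=
  fun F => PreservesDirectedColimits.{w} F

/-- The category `S(A) = Acc_ω(A, Set)`: functors from `A` to sets which preserve directed
colimits, with all natural transformations between them. -/
abbrev ScottTopos (A : Type u) [Category.{v} A] :=
  (preservesDirectedColimits.{w} A).FullSubcategory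

/-- `E` is a Grothendieck topos (relative to the universe `w` of small sets): it is equivalent to
the category of sheaves of sets on a small site. -/
def IsGrothendieckTopos (E : Type u) [Category.{v} E] : Prop :=
  ∃ (C : Type w) (_ : SmallCategory C) (J : GrothendieckTopology C),
    Nonempty (E ≌ Sheaf J (Type w))

/-- The category `A_κ`: the full subcategory of `A` on the `κ`-presentable objects. -/
abbrev Presentables (A : Type u) [Category.{v} A] (κ : Cardinal.{w}) [Fact κ.IsRegular] :=
  (isCardinalPresentable A κ).FullSubcategory

/-- The comparison functor `S(A) ⥤ Set^{A_κ}`, restricting `F : A ⥤ Type w` to `A_κ`. -/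
abbrev restriction (A : Type u) [Category.{v} A] (κ : Cardinal.{w}) [Fact κ.IsRegular] :
    ScottTopos.{w} A ⥤ (Presentables A κ ⥤ Type w) :=
  (preservesDirectedColimits.{w} A).ι ⋙
    (Functor.whiskeringLeft (Presentables A κ) A (Type w)).obj (isCardinalPresentable A κ).ι

end Scott

/-! Let `j : D ⥤ A` be a small model of the inclusion of `A_κ`: it is dense and its slices are
filtered. A functor `F` preserving directed colimits is the left Kan extension of `j ⋙ F`, so
restriction is fully faithful. Finite limits and small colimits of such functors are pointwise, so
the essential image `E` of restriction in `D ⥤ Type w` is closed under both. What remains is a small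
generating family.

The family comes from a size bound. A map from a `κ`-presentable object to a directed colimit
factors through the colimit of a diagram `Finset U ⥤ D` with `U ⊆ κ.ord.ToType`
(`exists_factorization_colimit`). There is only a small set of such diagrams. Closing one element of
`F` under a chosen witness for each of them generates a subfunctor that still preserves directed
colimits and whose size is bounded independently of `F` (`exists_small_subfunctor`).

A Giraud-type argument then applies. Let `C` be the full subcategory of members of `E` within the
bound, with jointly surjective sieves as covers. The nerve identifies `E` with sheaves on `C`, and
`Hom(F, P) ≃ Hom(nerve F, nerve P)` for `F` in `E` and arbitrary `P`, which gives the right adjoint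
`r`. The comonad is left exact because `r` preserves limits and `i` preserves finite limits. -/

namespace Scott

/-! ### Sheaf representation of a class of functors with a small generating family -/

section Giraud

open Opposite

variable {D : Type w} [SmallCategory D] {C : Type w} [SmallCategory C]

/-- The functor `g` generates the property `E` of functors: it takes its values in `E`, every
element of a functor satisfying `E` is in the image of a morphism from a value of `g`, and `E` is
closed under fibre products, equalizers and small colimits. -/
structure IsGenerating (E : ObjectProperty (D ⥤ Type w)) (g : C ⥤ D ⥤ Type w) : Prop where
  prop_obj (X : C) : E (g.obj X)
  exists_app_eq {F : D ⥤ Type w} (hF : E F) {d : D} (x : F.obj d) :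
    ∃ (X : C) (φ : g.obj X ⟶ F) (y : (g.obj X).obj d), φ.app d y = x
  pullback : E.IsClosedUnderLimitsOfShape WalkingCospan
  equalizer : E.IsClosedUnderLimitsOfShape WalkingParallelPair
  colimit (J : Type w) [SmallCategory J] : E.IsClosedUnderColimitsOfShape J

namespace IsGenerating

variable {E : ObjectProperty (D ⥤ Type w)} {g : C ⥤ D ⥤ Type w} (hg : IsGenerating E g)

include hg

/-- A generator hits the point `(x, y)` of the fibre product, which lies in `E`; fullness turns the
two projections into morphisms of `C`. This replaces pullbacks in `C`, which need not exist. -/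
lemma exists_span [g.Full] {F : D ⥤ Type w} (hF : E F) {X Y : C} (φ : g.obj X ⟶ F)
    (ψ : g.obj Y ⟶ F) {d : D} (x : (g.obj X).obj d) (y : (g.obj Y).obj d)
    (h : φ.app d x = ψ.app d y) :
    ∃ (Z : C) (u : Z ⟶ X) (v : Z ⟶ Y) (z : (g.obj Z).obj d),
      (g.map u).app d z = x ∧ (g.map v).app d z = y ∧ g.map u ≫ φ = g.map v ≫ ψ := by
  have hP : E (Limits.pullback φ ψ) := by
    have := hg.pullback
    refine E.prop_limit _ ?_
    rintro (_ | _ | _)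
    exacts [hF, hg.prop_obj X, hg.prop_obj Y]
  obtain ⟨p, hp₁, hp₂⟩ : ∃ p : (Limits.pullback φ ψ).obj d,
      (pullback.fst φ ψ).app d p = x ∧ (pullback.snd φ ψ).app d p = y := by
    have hpb := ((IsPullback.of_hasPullback φ ψ).map ((evaluation D (Type w)).obj d))
    obtain ⟨p, h₁, h₂⟩ := Types.exists_of_isPullback hpb x y h
    exact ⟨p, h₁, h₂⟩
  obtain ⟨Z, ζ, z, rfl⟩ := hg.exists_app_eq hP p
  refine ⟨Z, g.preimage (ζ ≫ pullback.fst φ ψ), g.preimage (ζ ≫ pullback.snd φ ψ), z, ?_, ?_, ?_⟩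
  · simpa using hp₁
  · simpa using hp₂
  · simp [pullback.condition]

lemma exists_equalizing [g.Full] [g.Faithful] {X Y : C} (u v : X ⟶ Y) {d : D}
    (x : (g.obj X).obj d) (h : (g.map u).app d x = (g.map v).app d x) :
    ∃ (Z : C) (r : Z ⟶ X) (z : (g.obj Z).obj d), (g.map r).app d z = x ∧ r ≫ u = r ≫ v := by
  have hP : E (Limits.equalizer (g.map u) (g.map v)) := by
    have := hg.equalizer
    refine E.prop_limit _ ?_
    rintro (_ | _)
    exacts [hg.prop_obj X, hg.prop_obj Y]
  obtain ⟨p, hp⟩ : ∃ p : (Limits.equalizer (g.map u) (g.map v)).obj d,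
      (equalizer.ι (g.map u) (g.map v)).app d p = x := by
    have hl := isLimitForkMapOfIsLimit ((evaluation D (Type w)).obj d) _
      (equalizerIsEqualizer (g.map u) (g.map v))
    obtain ⟨p, hp, -⟩ := (Types.type_equalizer_iff_unique _ (NatTrans.congr_app
      (equalizer.condition (g.map u) (g.map v)) d)).1 ⟨hl⟩ x h
    exact ⟨p, hp⟩
  obtain ⟨Z, ζ, z, rfl⟩ := hg.exists_app_eq hP p
  refine ⟨Z, g.preimage (ζ ≫ equalizer.ι _ _), z, by simpa using hp, g.map_injective ?_⟩
  rw [Functor.map_comp, Functor.map_comp, Functor.map_preimage, Category.assoc, Category.assoc]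
  exact congrArg (ζ ≫ ·) (equalizer.condition _ _)

omit hg in
lemma hom_ext_of_cover {F P : D ⥤ Type w} (S : ∀ X : C, (g.obj X ⟶ F) → Prop)
    (hS : ∀ (d : D) (x : F.obj d), ∃ (X : C) (φ : g.obj X ⟶ F) (_ : S X φ)
      (y : (g.obj X).obj d), φ.app d y = x)
    {α β : F ⟶ P} (h : ∀ (X : C) (φ : g.obj X ⟶ F), S X φ → φ ≫ α = φ ≫ β) : α = β := by
  ext d x
  obtain ⟨X, φ, hφ, y, rfl⟩ := hS d x
  exact ConcreteCategory.congr_hom (NatTrans.congr_app (h X φ hφ) d) y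

/-- The value at an element is read off from any member of `S` hitting it; `exists_span` makes this
independent of the choice. The target `P` need not lie in `E`, which is what later yields a right
adjoint on all of `D ⥤ Type w`. -/
lemma exists_glue [g.Full] {F P : D ⥤ Type w} (hF : E F) (S : ∀ X : C, (g.obj X ⟶ F) → Prop)
    (hS : ∀ (d : D) (x : F.obj d), ∃ (X : C) (φ : g.obj X ⟶ F) (_ : S X φ)
      (y : (g.obj X).obj d), φ.app d y = x)
    (hS' : ∀ ⦃X Y : C⦄ (u : Y ⟶ X) (φ : g.obj X ⟶ F), S X φ → S Y (g.map u ≫ φ))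
    (t : ∀ (X : C) (φ : g.obj X ⟶ F), S X φ → (g.obj X ⟶ P))
    (ht : ∀ ⦃X Y : C⦄ (u : Y ⟶ X) (φ : g.obj X ⟶ F) (hφ : S X φ),
      t Y (g.map u ≫ φ) (hS' u φ hφ) = g.map u ≫ t X φ hφ) :
    ∃ m : F ⟶ P, ∀ (X : C) (φ : g.obj X ⟶ F) (hφ : S X φ), φ ≫ m = t X φ hφ := by
  choose X φ hφ y hy using hS
  have key : ∀ {d : D} {Y Y' : C} (ψ : g.obj Y ⟶ F) (hψ : S Y ψ) (ψ' : g.obj Y' ⟶ F)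
      (hψ' : S Y' ψ') (z : (g.obj Y).obj d) (z' : (g.obj Y').obj d),
      ψ.app d z = ψ'.app d z' → (t Y ψ hψ).app d z = (t Y' ψ' hψ').app d z' := by
    intro d Y Y' ψ hψ ψ' hψ' z z' h
    obtain ⟨Z, u, v, s, rfl, rfl, huv⟩ := hg.exists_span hF ψ ψ' z z' h
    have h₁ := ht u ψ hψ
    have h₂ := ht v ψ' hψ'
    simp only [huv] at h₁
    exact ConcreteCategory.congr_hom (NatTrans.congr_app (h₁.symm.trans h₂) d) s
  refine ⟨{ app d := ↾fun x ↦ (t _ _ (hφ d x)).app d (y d x), naturality d d' f := ?_ }, ?_⟩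
  · ext x
    have h := NatTrans.naturality_apply (t _ _ (hφ d x)) f (y d x)
    refine Eq.trans ?_ h
    refine key _ _ _ _ _ _ ?_
    rw [hy, NatTrans.naturality_apply, hy]
    rfl
  · intro Y ψ hψ
    ext d z
    exact key _ _ _ _ _ _ (hy _ _)

/-- The topology on `C` for which a sieve covers if its image under `g` is jointly surjective. -/
def topology [g.Full] [g.Faithful] : GrothendieckTopology C where
  sieves X := {S | ∀ (d : D) (x : (g.obj X).obj d), ∃ (Y : C) (f : Y ⟶ X) (_ : S f)
      (y : (g.obj Y).obj d), (g.map f).app d y = x}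
  top_mem' X d x := ⟨X, 𝟙 X, trivial, x, by simp⟩
  pullback_stable' X Y S f hS d y := by
    obtain ⟨Z, h, hh, z, hz⟩ := hS d ((g.map f).app d y)
    obtain ⟨K, u, v, k, rfl, rfl, huv⟩ :=
      hg.exists_span (hg.prop_obj X) (g.map f) (g.map h) y z hz.symm
    have huv' : u ≫ f = v ≫ h := g.map_injective (by simpa using huv)
    exact ⟨K, u, by simpa [huv'] using S.downward_closed hh v, k, rfl⟩
  transitive' X S hS R hR d x := by
    obtain ⟨Y, f, hf, y, rfl⟩ := hS d x
    obtain ⟨Z, h, hh, z, rfl⟩ := hR hf d y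
    exact ⟨Z, h ≫ f, hh, z, by simp⟩

lemma bijective_whiskerLeft_map [g.Full] (P : D ⥤ Type w) {F : D ⥤ Type w} (hF : E F) :
    Function.Bijective (fun (α : F ⟶ P) ↦
      (Functor.whiskerLeft g.op (yoneda.map α) : g.op ⋙ yoneda.obj F ⟶ g.op ⋙ yoneda.obj P)) := by
  have hS (d : D) (x : F.obj d) : ∃ (X : C) (φ : g.obj X ⟶ F) (_ : True)
      (y : (g.obj X).obj d), φ.app d y = x := by
    obtain ⟨X, φ, y, h⟩ := hg.exists_app_eq hF x
    exact ⟨X, φ, trivial, y, h⟩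
  refine ⟨fun α β h ↦ hom_ext_of_cover (fun _ _ ↦ True) hS fun X φ _ ↦
    ConcreteCategory.congr_hom (NatTrans.congr_app h (op X)) φ, fun τ ↦ ?_⟩
  obtain ⟨m, hm⟩ := hg.exists_glue (P := P) hF (fun _ _ ↦ True) hS (fun _ _ _ _ _ ↦ trivial)
    (fun X φ _ ↦ τ.app (op X) φ) (fun X Y u φ _ ↦ NatTrans.naturality_apply τ u.op φ)
  refine ⟨m, ?_⟩
  ext X φ
  exact hm X.unop φ trivial

variable [g.Full] [g.Faithful]

lemma isSheaf_nerve (P : D ⥤ Type w) :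
    Presieve.IsSheaf hg.topology (g.op ⋙ yoneda.obj P) := by
  intro X S hS t ht
  have hS' (d : D) (x : (g.obj X).obj d) : ∃ (Y : C) (φ : g.obj Y ⟶ g.obj X)
      (_ : S (g.preimage φ)) (y : (g.obj Y).obj d), φ.app d y = x := by
    obtain ⟨Y, f, hf, y, h⟩ := hS d x
    exact ⟨Y, g.map f, by simpa using hf, y, h⟩
  have hpre {Y Z : C} (u : Z ⟶ Y) (φ : g.obj Y ⟶ g.obj X) :
      g.preimage (g.map u ≫ φ) = u ≫ g.preimage φ := g.map_injective (by simp)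
  have hdc : ∀ ⦃Y Z : C⦄ (u : Z ⟶ Y) (φ : g.obj Y ⟶ g.obj X), S (g.preimage φ) →
      S (g.preimage (g.map u ≫ φ)) := fun Y Z u φ hφ ↦ by
    rw [hpre]
    exact S.downward_closed hφ u
  have ht' := (Presieve.compatible_iff_sieveCompatible t).1 ht
  obtain ⟨m, hm⟩ := hg.exists_glue (P := P) (hg.prop_obj X) (fun Y φ ↦ S (g.preimage φ)) hS'
    hdc (fun Y φ hφ ↦ t (g.preimage φ) hφ) (fun Y Z u φ hφ ↦ by
      refine Eq.trans ?_ (ht' (g.preimage φ) u hφ)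
      congr 1
      exact hpre u φ)
  refine ⟨m, fun Y f hf ↦ ?_, fun m' hm' ↦ ?_⟩
  · have h : ∀ (f' : Y ⟶ X) (_ : f' = f) (h' : S f'), t f' h' = t f hf := by
      rintro _ rfl _
      rfl
    exact (hm Y (g.map f) (by simpa using hf)).trans (h _ (by simp) _)
  · refine hom_ext_of_cover (fun Y φ ↦ S (g.preimage φ)) hS' fun Y φ hφ ↦ ?_
    have h₁ := hm' (g.preimage φ) hφ
    have h₂ := hm Y φ hφ
    rw [h₂, ← h₁]
    simp

/-- The functor sending a functor `P` to the sheaf of morphisms from the values of `g` to `P`. -/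
def nerve : (D ⥤ Type w) ⥤ Sheaf hg.topology (Type w) where
  obj P := ⟨g.op ⋙ yoneda.obj P, (isSheaf_iff_isSheaf_of_type _ _).2 (hg.isSheaf_nerve P)⟩
  map α := ⟨Functor.whiskerLeft g.op (yoneda.map α)⟩

lemma nerve_map_bijective {F : D ⥤ Type w} (hF : E F) (P : D ⥤ Type w) :
    Function.Bijective (fun α : F ⟶ P ↦ hg.nerve.map α) := by
  have h := hg.bijective_whiskerLeft_map P hF
  exact ⟨fun α β hαβ ↦ h.1 (congrArg (·.hom) hαβ), fun τ ↦ by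
    obtain ⟨α, hα⟩ := h.2 τ.hom
    exact ⟨α, Sheaf.hom_ext hα⟩⟩

/-- The colimit of the values of `g` over the elements of a presheaf. -/
noncomputable abbrev realization (_ : IsGenerating E g) (P : Cᵒᵖ ⥤ Type w) : D ⥤ Type w :=
  Limits.colimit ((CategoryOfElements.π P).leftOp ⋙ g)

/-- The morphism to the realization given by a section of a presheaf. -/
noncomputable abbrev toRealization (P : Cᵒᵖ ⥤ Type w) {X : C} (p : P.obj (op X)) :
    g.obj X ⟶ hg.realization P :=
  colimit.ι ((CategoryOfElements.π P).leftOp ⋙ g) (op ⟨op X, p⟩)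

omit [g.Full] [g.Faithful] in
lemma prop_realization (P : Cᵒᵖ ⥤ Type w) : E (hg.realization P) := by
  have := hg.colimit P.Elementsᵒᵖ
  exact E.prop_colimit _ fun X ↦ hg.prop_obj _

omit [g.Full] [g.Faithful] in
lemma map_toRealization (P : Cᵒᵖ ⥤ Type w) {X Y : C} (u : Y ⟶ X) (p : P.obj (op X)) :
    g.map u ≫ hg.toRealization P p = hg.toRealization P (P.map u.op p) :=
  colimit.w ((CategoryOfElements.π P).leftOp ⋙ g)
    (Quiver.Hom.op (CategoryOfElements.homMk (F := P) ⟨op X, p⟩ ⟨op Y, P.map u.op p⟩ u.op rfl))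

omit [g.Full] [g.Faithful] in
lemma exists_toRealization_app_eq (P : Cᵒᵖ ⥤ Type w) {d : D} (x : (hg.realization P).obj d) :
    ∃ (X : C) (p : P.obj (op X)) (y : (g.obj X).obj d), (hg.toRealization P p).app d y = x := by
  obtain ⟨⟨X, p⟩, y, hy⟩ := Types.jointly_surjective_of_isColimit (isColimitOfPreserves
    ((evaluation D (Type w)).obj d) (colimit.isColimit ((CategoryOfElements.π P).leftOp ⋙ g))) x
  exact ⟨_, p, y, hy⟩

omit hg [g.Full] [g.Faithful] in
lemma map_id_app (X : C) {d : D} (x : (g.obj X).obj d) : (g.map (𝟙 X)).app d x = x := by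
  simp

/-- Being joined by a span that identifies the two sections contains the relation generating the
colimit. It is already an equivalence relation: `exists_span` over the middle object gives
transitivity. -/
lemma exists_of_toRealization_app_eq (P : Cᵒᵖ ⥤ Type w) {X Y : C} (p : P.obj (op X))
    (q : P.obj (op Y)) {d : D} (x : (g.obj X).obj d) (y : (g.obj Y).obj d)
    (h : (hg.toRealization P p).app d x = (hg.toRealization P q).app d y) :
    ∃ (Z : C) (u : Z ⟶ X) (v : Z ⟶ Y) (z : (g.obj Z).obj d), (g.map u).app d z = x ∧
      (g.map v).app d z = y ∧ P.map u.op p = P.map v.op q := by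
  let K := (CategoryOfElements.π P).leftOp ⋙ g
  let ev := (evaluation D (Type w)).obj d
  let R : (Σ j, (K ⋙ ev).obj j) → (Σ j, (K ⋙ ev).obj j) → Prop := fun a b ↦
    ∃ (Z : C) (u : Z ⟶ a.1.unop.1.unop) (v : Z ⟶ b.1.unop.1.unop) (z : (g.obj Z).obj d),
      (g.map u).app d z = a.2 ∧ (g.map v).app d z = b.2 ∧
        P.map u.op a.1.unop.2 = P.map v.op b.1.unop.2
  have hR : _root_.Equivalence R := by
    refine ⟨fun a ↦ ⟨_, 𝟙 _, 𝟙 _, a.2, map_id_app _ _, map_id_app _ _, rfl⟩, ?_, ?_⟩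
    · rintro a b ⟨Z, u, v, z, h₁, h₂, h₃⟩
      exact ⟨Z, v, u, z, h₂, h₁, h₃.symm⟩
    · rintro a b c ⟨Z, u, v, z, h₁, h₂, h₃⟩ ⟨Z', u', v', z', h₁', h₂', h₃'⟩
      obtain ⟨T, r, s, t, rfl, rfl, hrs⟩ := hg.exists_span (hg.prop_obj b.1.unop.1.unop)
        (g.map v) (g.map u') z z' (h₂.trans h₁'.symm)
      have hrs' : r ≫ v = s ≫ u' := g.map_injective (by simpa using hrs)
      refine ⟨T, r ≫ u, s ≫ v', t, by simpa using h₁, by simpa using h₂', ?_⟩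
      calc P.map (r ≫ u).op a.1.unop.2 = P.map r.op (P.map u.op a.1.unop.2) := by simp
        _ = P.map (r ≫ v).op b.1.unop.2 := by rw [h₃]; simp
        _ = P.map s.op (P.map u'.op b.1.unop.2) := by rw [hrs']; simp
        _ = _ := by rw [h₃']; simp
  have hR' : ∀ a b, (K ⋙ ev).ColimitTypeRel a b → R a b := by
    rintro ⟨a, x⟩ ⟨b, y⟩ ⟨f, hf⟩
    exact ⟨_, 𝟙 _, f.unop.1.unop, x, map_id_app _ _, hf.symm, by
      simp⟩
  have hc := isColimitOfPreserves ev (colimit.isColimit K)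
  have h' : colimit.ι (K ⋙ ev) (op ⟨op X, p⟩) x = colimit.ι (K ⋙ ev) (op ⟨op Y, q⟩) y := by
    have e₁ := hc.comp_coconePointUniqueUpToIso_hom (colimit.isColimit _) (op ⟨op X, p⟩)
    have e₂ := hc.comp_coconePointUniqueUpToIso_hom (colimit.isColimit _) (op ⟨op Y, q⟩)
    have e₁' := ConcreteCategory.congr_hom e₁ x
    have e₂' := ConcreteCategory.congr_hom e₂ y
    refine e₁'.symm.trans (Eq.trans ?_ e₂')
    exact congrArg (hc.coconePointUniqueUpToIso (colimit.isColimit _)).hom h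
  exact hR.eqvGen_iff.1 ((Types.colimit_eq h').mono hR')

/-- The morphism from a sheaf to the nerve of its realization. -/
noncomputable def unitNerve (P : Sheaf hg.topology (Type w)) :
    P ⟶ hg.nerve.obj (hg.realization P.obj) where
  hom :=
    { app X := ↾fun p ↦ hg.toRealization P.obj (X := X.unop) p
      naturality X Y f := by
        ext p
        exact (hg.map_toRealization P.obj f.unop p).symm }

lemma unitNerve_injective (P : Sheaf hg.topology (Type w)) {X : C} {p q : P.obj.obj (op X)}
    (h : hg.toRealization P.obj p = hg.toRealization P.obj q) : p = q := by
  let S : Sieve X :=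
    { arrows := fun Y f ↦ P.obj.map f.op p = P.obj.map f.op q
      downward_closed := fun {Y Z f} hf u ↦ by
        simp only [op_comp, Functor.map_comp_apply, hf] }
  -- The span joining `x` to itself may have distinct legs `u` and `v`; passing to a generator of
  -- their equalizer makes them agree.
  have hS : S ∈ hg.topology X := fun d x ↦ by
    obtain ⟨Z, u, v, z, hu, hv, huv⟩ := hg.exists_of_toRealization_app_eq P.obj p q x x (by rw [h])
    obtain ⟨T, r, t, rfl, hr⟩ := hg.exists_equalizing u v z (hu.trans hv.symm)
    refine ⟨T, r ≫ u, ?_, t, by simpa using hu⟩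
    change P.obj.map (r ≫ u).op p = P.obj.map (r ≫ u).op q
    rw [op_comp, Functor.map_comp_apply, huv, ← Functor.map_comp_apply, ← op_comp, ← op_comp, hr]
  exact (((isSheaf_iff_isSheaf_of_type _ _).1 P.property).isSeparated S hS).ext
    fun Y f hf ↦ hf

/-- Locally `φ` comes from sections of `P`; these are compatible by `unitNerve_injective`, so the
sheaf condition glues them. -/
lemma unitNerve_surjective (P : Sheaf hg.topology (Type w)) {X : C}
    (φ : g.obj X ⟶ hg.realization P.obj) :
    ∃ p : P.obj.obj (op X), hg.toRealization P.obj p = φ := by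
  let S : Sieve X :=
    { arrows := fun Y f ↦ ∃ p : P.obj.obj (op Y), hg.toRealization P.obj p = g.map f ≫ φ
      downward_closed := fun {Y Z f} hf u ↦ by
        obtain ⟨p, hp⟩ := hf
        exact ⟨P.obj.map u.op p, by rw [← map_toRealization, hp, Functor.map_comp_assoc]⟩ }
  have hS : S ∈ hg.topology X := fun d x ↦ by
    obtain ⟨Y, q, y, hy⟩ := hg.exists_toRealization_app_eq P.obj (φ.app d x)
    obtain ⟨Z, u, v, z, rfl, rfl, huv⟩ := hg.exists_span (hg.prop_realization P.obj) φ
      (hg.toRealization P.obj q) x y hy.symm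
    exact ⟨Z, u, ⟨P.obj.map v.op q, by rw [huv, map_toRealization]⟩, z, rfl⟩
  have hsheaf := (isSheaf_iff_isSheaf_of_type _ _).1 P.property S hS
  choose t ht using fun (Y : C) (f : Y ⟶ X) (hf : S f) ↦ hf
  obtain ⟨p, hp, -⟩ := hsheaf (fun Y f hf ↦ t Y f hf)
    ((Presieve.compatible_iff_sieveCompatible _).2 fun Y Z f u hf ↦ by
      apply hg.unitNerve_injective P
      rw [ht, ← map_toRealization, ht, Functor.map_comp_assoc])
  refine ⟨p, hom_ext_of_cover (fun Y ψ ↦ S (g.preimage ψ)) (fun d x ↦ ?_) fun Y ψ hψ ↦ ?_⟩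
  · obtain ⟨Y, f, hf, y, h⟩ := hS d x
    exact ⟨Y, g.map f, by simpa using hf, y, h⟩
  · obtain ⟨f, rfl⟩ := g.map_surjective ψ
    have hf : S f := by simpa using hψ
    rw [map_toRealization, ← ht Y f hf]
    exact congrArg _ (hp f hf)

instance isIso_unitNerve (P : Sheaf hg.topology (Type w)) : IsIso (hg.unitNerve P) := by
  have : IsIso ((sheafToPresheaf _ _).map (hg.unitNerve P)) := by
    rw [NatTrans.isIso_iff_isIso_app]
    intro X
    rw [isIso_iff_bijective]
    exact ⟨fun _ _ h ↦ hg.unitNerve_injective P h, fun φ ↦ hg.unitNerve_surjective P φ⟩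
  exact isIso_of_reflects_iso _ (sheafToPresheaf _ _)

instance : (E.ι ⋙ hg.nerve).Faithful where
  map_injective {F G} _ _ h :=
    ObjectProperty.hom_ext _ ((hg.nerve_map_bijective F.property G.obj).1 h)

instance : (E.ι ⋙ hg.nerve).Full where
  map_surjective {F G} τ := by
    obtain ⟨α, hα⟩ := (hg.nerve_map_bijective F.property G.obj).2 τ
    exact ⟨ObjectProperty.homMk α, hα⟩

instance : (E.ι ⋙ hg.nerve).EssSurj where
  mem_essImage P :=
    ⟨⟨hg.realization P.obj, hg.prop_realization P.obj⟩, ⟨(asIso (hg.unitNerve P)).symm⟩⟩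

instance : (E.ι ⋙ hg.nerve).IsEquivalence where

lemma isGrothendieckTopos : IsGrothendieckTopos.{w} E.FullSubcategory :=
  ⟨C, inferInstance, hg.topology, ⟨(E.ι ⋙ hg.nerve).asEquivalence⟩⟩

/-- The right adjoint is the nerve followed by the inverse of the equivalence of `E` with sheaves.
-/
lemma isLeftAdjoint_ι : E.ι.IsLeftAdjoint :=
  let e := (E.ι ⋙ hg.nerve).asEquivalence
  (Adjunction.mkOfHomEquiv (F := E.ι) (G := hg.nerve ⋙ e.inverse)
    { homEquiv := fun F P ↦ (Equiv.ofBijective _ (hg.nerve_map_bijective F.property P)).trans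
        (e.toAdjunction.homEquiv F (hg.nerve.obj P))
      homEquiv_naturality_left_symm := fun {F' F P} f h ↦ by
        rw [Equiv.symm_apply_eq]
        obtain ⟨α, rfl⟩ := ((Equiv.ofBijective _ (hg.nerve_map_bijective F.property P)).trans
          (e.toAdjunction.homEquiv F (hg.nerve.obj P))).surjective h
        rw [Equiv.symm_apply_apply]
        exact ((congrArg (e.toAdjunction.homEquiv F' (hg.nerve.obj P))
          (hg.nerve.map_comp (E.ι.map f) α)).trans
            (e.toAdjunction.homEquiv_naturality_left f (hg.nerve.map α))).symm
      homEquiv_naturality_right := fun {F P P'} f h ↦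
        (congrArg (e.toAdjunction.homEquiv F (hg.nerve.obj P')) (hg.nerve.map_comp f h)).trans
          (e.toAdjunction.homEquiv_naturality_right (hg.nerve.map f) (hg.nerve.map h)) }).isLeftAdjoint

end IsGenerating
end Giraud
end Scott

namespace Scott

/-! ### Maps from presentable objects to directed colimits -/

section Directed

/-- By strong induction, the bound of `s` is chosen above the elements of `s` and above the bounds
of all its proper subsets. -/
lemma exists_monotone_upperBound (P : Type w) [PartialOrder P] [IsDirectedOrder P] [Nonempty P] :
    ∃ h : Finset P → P, Monotone h ∧ ∀ (s : Finset P), ∀ p ∈ s, p ≤ h s := by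
  classical
  have ex (s : Finset P) (H : ∀ t ⊂ s, P) : ∃ b : P, (∀ p ∈ s, p ≤ b) ∧ ∀ t ht, H t ht ≤ b := by
    let B : Finset P := s ∪ s.ssubsets.attach.image
      (fun t : { t // t ∈ s.ssubsets } ↦ H t.1 (Finset.mem_ssubsets.1 t.2))
    obtain ⟨b, hb⟩ := Finset.exists_le B
    refine ⟨b, fun p hp ↦ hb p (Finset.mem_union_left _ hp), fun t ht ↦
      hb _ (Finset.mem_union_right _ (Finset.mem_image.2
        ⟨⟨t, Finset.mem_ssubsets.2 ht⟩, Finset.mem_attach _ _, rfl⟩))⟩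
  let h : Finset P → P := fun s ↦ Finset.strongInduction (fun s H ↦ (ex s H).choose) s
  have eq (s : Finset P) : h s = (ex s fun t _ ↦ h t).choose := Finset.strongInduction_eq _ _
  refine ⟨h, fun s t hst ↦ ?_, fun s p hp ↦ ?_⟩
  · obtain rfl | hst := eq_or_ssubset_of_subset hst
    · rfl
    · rw [eq t]
      exact (ex t fun t _ ↦ h t).choose_spec.2 s hst
  · rw [eq s]
    exact (ex s fun t _ ↦ h t).choose_spec.1 p hp

variable {A : Type u} [Category.{w} A] [HasDirectedColimits.{w} A]

instance (I : Type w) [PartialOrder I] [IsDirectedOrder I] [Nonempty I] :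
    HasColimitsOfShape I A := HasDirectedColimits.hasColimitsOfShape I

/-- The poset of finite subsets of a set. -/
abbrev FinsetIn {P : Type w} (S : Set P) := { s : Finset P // (s : Set P) ⊆ S }

namespace FinsetIn

variable {P : Type w} (S : Set P)

instance : Nonempty (FinsetIn S) := ⟨⟨∅, by simp⟩⟩

instance : IsDirectedOrder (FinsetIn S) where
  directed s t := by
    classical
    exact ⟨⟨s.1 ∪ t.1, by simpa using ⟨s.2, t.2⟩⟩, Finset.subset_union_left,
      Finset.subset_union_right⟩

variable [PartialOrder P] {h : Finset P → P} (hh : Monotone h) (K : P ⥤ A)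

/-- The diagram indexed by the finite subsets of `S` obtained from a monotone map on finite
subsets. -/
abbrev diagram : FinsetIn S ⥤ P := Monotone.functor (f := fun s : FinsetIn S ↦ h s.1)
  fun _ _ hst ↦ hh hst

/-- The colimit of the diagram indexed by the finite subsets of `S`. -/
noncomputable def colimitOn : A := colimit (diagram S hh ⋙ K)

/-- The coprojections to the colimit of the diagram indexed by the finite subsets of `S`. -/
noncomputable def ι (s : FinsetIn S) : K.obj (h s.1) ⟶ colimitOn S hh K :=
  colimit.ι (diagram S hh ⋙ K) s

variable {S} in
lemma map_ι {s t : FinsetIn S} (hst : s ≤ t) :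
    K.map (homOfLE (hh hst)) ≫ ι S hh K t = ι S hh K s :=
  colimit.w (diagram S hh ⋙ K) (homOfLE hst)

variable {S hh K} in
lemma hom_ext {X : A} {f g : colimitOn S hh K ⟶ X}
    (hfg : ∀ s, ι S hh K s ≫ f = ι S hh K s ≫ g) : f = g :=
  colimit.hom_ext hfg

variable {X : A} (f : ∀ s : FinsetIn S, K.obj (h s.1) ⟶ X)
  (hf : ∀ (s t : FinsetIn S) (hst : s ≤ t), K.map (homOfLE (hh hst)) ≫ f t = f s)

/-- The universal property of the colimit of the diagram indexed by the finite subsets of `S`. -/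
noncomputable def desc : colimitOn S hh K ⟶ X :=
  colimit.desc (diagram S hh ⋙ K)
    { pt := X
      ι :=
        { app := f
          naturality s t i := (hf s t (leOfHom i)).trans (Category.comp_id _).symm } }

@[simp]
lemma ι_desc (s : FinsetIn S) : ι S hh K s ≫ desc S hh K f hf = f s :=
  colimit.ι_desc _ _

variable {S} in
/-- The morphism between colimits induced by an inclusion of sets. -/
noncomputable def incl {S' : Set P} (hS : S ⊆ S') : colimitOn S hh K ⟶ colimitOn S' hh K :=
  desc S hh K (fun s ↦ ι S' hh K ⟨s.1, s.2.trans hS⟩) fun s t hst ↦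
    map_ι hh K (s := ⟨s.1, s.2.trans hS⟩) (t := ⟨t.1, t.2.trans hS⟩) hst

lemma ι_incl {S' : Set P} (hS : S ⊆ S') (s : FinsetIn S) :
    ι S hh K s ≫ incl hh K hS = ι S' hh K ⟨s.1, s.2.trans hS⟩ :=
  ι_desc _ _ _ _ _ _

variable (κ : Cardinal.{w}) [Fact κ.IsRegular]

/-- The colimits of the diagrams indexed by the finite subsets of sets of cardinality `< κ`. -/
noncomputable abbrev colimitFunctor : HasCardinalLT.Set P κ ⥤ A where
  obj S := colimitOn S.1 hh K
  map i := incl hh K (leOfHom i)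
  map_id S := hom_ext fun s ↦ by simp [ι_incl]
  map_comp f g := hom_ext fun s ↦ by
    rw [← Category.assoc, ι_incl, ι_incl, ι_incl]

/-- The cocone of the colimits indexed by finite subsets of small sets. -/
noncomputable abbrev colimitCocone (c : Cocone K) : Cocone (colimitFunctor hh K κ) where
  pt := c.pt
  ι :=
    { app S := desc S.1 hh K (fun s ↦ c.ι.app (h s.1)) fun s t hst ↦ c.w _
      naturality S S' i := hom_ext fun s ↦ by
        rw [← Category.assoc, ι_incl]
        simp }

variable {κ} in
/-- The morphism to a colimit indexed by finite subsets given by an upper bound. -/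
noncomputable def toColimit {p : P} {S : HasCardinalLT.Set P κ} (s : FinsetIn S.1)
    (hp : p ≤ h s.1) : K.obj p ⟶ colimitOn S.1 hh K :=
  K.map (homOfLE hp) ≫ ι S.1 hh K s

/-- Both sides are compared inside the union of the two small sets. -/
lemma toColimit_comp_eq (t : Cocone (colimitFunctor hh K κ)) {p : P}
    {S S' : HasCardinalLT.Set P κ} (s : FinsetIn S.1) (s' : FinsetIn S'.1) (hp : p ≤ h s.1)
    (hp' : p ≤ h s'.1) : toColimit hh K s hp ≫ t.ι.app S = toColimit hh K s' hp' ≫ t.ι.app S' := by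
  classical
  let T : HasCardinalLT.Set P κ := ⟨S.1 ∪ S'.1,
    hasCardinalLT_union (Cardinal.IsRegular.aleph0_le Fact.out) S.2 S'.2⟩
  let r : FinsetIn T.1 := ⟨s.1 ∪ s'.1, by
    simpa [T] using ⟨s.2.trans Set.subset_union_left, s'.2.trans Set.subset_union_right⟩⟩
  have aux {S : HasCardinalLT.Set P κ} (hS : S ≤ T) (s : FinsetIn S.1) (hp : p ≤ h s.1)
      (hs : s.1 ⊆ r.1) : toColimit hh K s hp ≫ t.ι.app S =
        toColimit hh K r (hp.trans (hh hs)) ≫ t.ι.app T := by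
    rw [← t.w (homOfLE hS), ← Category.assoc]
    congr 1
    have h₁ := map_ι hh K (s := ⟨s.1, s.2.trans hS⟩) (t := r) hs
    rw [toColimit, toColimit, Category.assoc, ι_incl, ← h₁, ← Category.assoc, ← K.map_comp]
    rfl
  rw [aux Set.subset_union_left s hp Finset.subset_union_left,
    aux Set.subset_union_right s' hp' Finset.subset_union_right]

omit [Fact κ.IsRegular] in
lemma map_toColimit {p q : P} (f : p ⟶ q) {S : HasCardinalLT.Set P κ} (s : FinsetIn S.1)
    (hq : q ≤ h s.1) :
    K.map f ≫ toColimit hh K s hq = toColimit hh K s ((leOfHom f).trans hq) := by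
  rw [toColimit, toColimit, ← Category.assoc, ← K.map_comp]
  rfl

omit [Fact κ.IsRegular] in
lemma toColimit_self {S : HasCardinalLT.Set P κ} (s : FinsetIn S.1) :
    toColimit hh K s le_rfl = ι S.1 hh K s := by
  have : homOfLE (le_refl (h s.1)) = 𝟙 _ := rfl
  rw [toColimit, this, K.map_id, Category.id_comp]

/-- A colimit over `P` is the colimit of the colimits indexed by finite subsets of small sets. -/
noncomputable def isColimitColimitCocone (hh' : ∀ (s : Finset P), ∀ p ∈ s, p ≤ h s)
    {c : Cocone K} (hc : IsColimit c) : IsColimit (colimitCocone hh K κ c) := by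
  -- A cocone on the small pieces restricts to one on `K` through singletons, since `p ≤ h {p}`.
  let S (p : P) : HasCardinalLT.Set P κ :=
    ⟨{p}, hasCardinalLT_of_finite _ _ (Cardinal.IsRegular.aleph0_le Fact.out)⟩
  let s (p : P) : FinsetIn (S p).1 := ⟨{p}, by simp [S]⟩
  have hs (p : P) : p ≤ h (s p).1 := hh' _ _ (by simp [s])
  let d (t : Cocone (colimitFunctor hh K κ)) : Cocone K :=
    { pt := t.pt
      ι :=
        { app p := toColimit hh K (s p) (hs p) ≫ t.ι.app (S p)
          naturality p q f := by
            rw [toColimit_comp_eq hh K κ t (s p) (s q) (hs p) ((leOfHom f).trans (hs q)),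
              ← Category.assoc, map_toColimit]
            exact (Category.comp_id _).symm } }
  have fac (t : Cocone (colimitFunctor hh K κ)) (p : P) :
      c.ι.app p ≫ hc.desc (d t) = toColimit hh K (s p) (hs p) ≫ t.ι.app (S p) := hc.fac _ _
  refine { desc := fun t ↦ hc.desc (d t), fac := fun t S' ↦ hom_ext fun r ↦ ?_,
           uniq := fun t m hm ↦ hc.hom_ext fun p ↦ ?_ }
  · rw [← Category.assoc, ι_desc, fac, toColimit_comp_eq hh K κ t (s _) r (hs _) le_rfl, toColimit_self]
  · rw [fac, ← hm, ← Category.assoc]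
    congr 1
    rw [toColimit, Category.assoc, ι_desc, c.w]

end FinsetIn

/-- The colimit is rewritten as a `κ`-filtered colimit, over subsets `Z` of size `< κ`, of colimits
over the finite subsets of `Z`; presentability selects one `Z`. Embedding `Z` in `κ.ord.ToType`
makes the possible shapes a set independent of `P`. -/
lemma exists_finset_factorization {P : Type w} [PartialOrder P] [IsDirectedOrder P] [Nonempty P]
    (K : P ⥤ A) {c : Cocone K} (hc : IsColimit c) (κ : Cardinal.{w}) [Fact κ.IsRegular]
    {X : A} [IsCardinalPresentable X κ] (f : X ⟶ c.pt) :
    ∃ (U : Set κ.ord.ToType) (φ : Finset U ⥤ P) (f' : X ⟶ colimit (φ ⋙ K)),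
      f' ≫ colimit.desc (φ ⋙ K) (c.whisker φ) = f := by
  obtain ⟨h, hh, hh'⟩ := exists_monotone_upperBound P
  obtain ⟨⟨Z, hZ⟩, f', hf'⟩ := IsCardinalPresentable.exists_hom_of_isColimit κ
    (FinsetIn.isColimitColimitCocone hh K κ hh' hc) f
  obtain ⟨ε⟩ : Nonempty (Z ↪ κ.ord.ToType) := by
    have := (hasCardinalLT_iff_cardinal_mk_lt _ _).1 hZ
    rw [← Cardinal.le_def]
    simpa using this.le
  classical
  let e : Z ≃ Set.range ε := Equiv.ofInjective _ ε.injective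
  let o : Finset (Set.range ε) ≃o FinsetIn Z :=
    { toFun := fun s ↦ ⟨s.map (e.symm.toEmbedding.trans (Function.Embedding.subtype _)), by
        intro x
        simp only [Finset.coe_map, Set.mem_image]
        rintro ⟨y, -, rfl⟩
        exact (e.symm y).2⟩
      invFun := fun s ↦ (s.1.subtype (· ∈ Z)).map e.toEmbedding
      left_inv := fun s ↦ by
        ext x
        simp only [Finset.mem_map, Finset.mem_subtype, Equiv.coe_toEmbedding]
        constructor
        · rintro ⟨y, ⟨z, hz, hzy⟩, rfl⟩
          have : e.symm z = y := Subtype.ext hzy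
          rwa [← this, e.apply_symm_apply]
        · exact fun hx ↦ ⟨e.symm x, ⟨x, hx, rfl⟩, e.apply_symm_apply x⟩
      right_inv := fun s ↦ by
        ext x
        simp only [Finset.mem_map]
        constructor
        · rintro ⟨y, ⟨z, hz, rfl⟩, rfl⟩
          simpa using hz
        · exact fun hx ↦ ⟨e ⟨x, s.2 hx⟩, ⟨⟨x, s.2 hx⟩, by simpa using hx, rfl⟩, by simp⟩
      map_rel_iff' := fun {s t} ↦ Finset.map_subset_map }
  let G := o.equivalence.functor
  obtain ⟨θ, hθ⟩ : ∃ θ : colimit ((G ⋙ FinsetIn.diagram Z hh) ⋙ K) ≅ FinsetIn.colimitOn Z hh K,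
      ∀ s, colimit.ι ((G ⋙ FinsetIn.diagram Z hh) ⋙ K) s ≫ θ.hom = FinsetIn.ι Z hh K (o s) :=
    ⟨Functor.Final.colimitIso G (FinsetIn.diagram Z hh ⋙ K), fun s ↦
      colimit.ι_pre (FinsetIn.diagram Z hh ⋙ K) G s⟩
  refine ⟨Set.range ε, G ⋙ FinsetIn.diagram Z hh, f' ≫ θ.inv, ?_⟩
  rw [← hf', Category.assoc]
  congr 1
  rw [Iso.inv_comp_eq]
  refine colimit.hom_ext fun s ↦ ?_
  rw [colimit.ι_desc, ← Category.assoc, hθ]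
  exact (FinsetIn.ι_desc Z hh K (fun s ↦ c.ι.app (h s.1)) (fun s t hst ↦ c.w _)
    (o s)).symm

end Directed
end Scott

namespace Scott

/-! ### Density and replacement of diagrams in `A` by diagrams in `D` -/

section Comma

open Functor

variable {A : Type u} [Category.{w} A] {D : Type w} [SmallCategory D] (j : D ⥤ A)

/-- The tautological cocone on the objects of `D` over an object. -/
def costructuredArrowCocone (X : A) : Cocone (CostructuredArrow.proj j X ⋙ j) where
  pt := X
  ι :=
    { app p := p.hom
      naturality _ _ f := (CostructuredArrow.w f).trans (Category.comp_id _).symm }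

/-- If `j` is dense, an object is the colimit of the objects of `D` over it. -/
noncomputable def isColimitCostructuredArrowCocone [j.IsDense] (X : A) :
    IsColimit (costructuredArrowCocone j X) :=
  IsColimit.ofIsoColimit (j.denseAt X) (Cocone.ext (Iso.refl _) fun p ↦
    (Category.comp_id _).trans (Category.id_comp p.hom))

lemma hom_ext_of_isDense [j.IsDense] {X Y : A} {f g : X ⟶ Y}
    (h : ∀ (d : D) (p : j.obj d ⟶ X), p ≫ f = p ≫ g) : f = g :=
  (isColimitCostructuredArrowCocone j X).hom_ext fun p ↦ h p.left p.hom

lemma exists_hom_of_isDense [j.IsDense] {X Y : A} (t : ∀ (d : D), (j.obj d ⟶ X) → (j.obj d ⟶ Y))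
    (ht : ∀ ⦃d d' : D⦄ (i : d ⟶ d') (p : j.obj d' ⟶ X), t d (j.map i ≫ p) = j.map i ≫ t d' p) :
    ∃ f : X ⟶ Y, ∀ (d : D) (p : j.obj d ⟶ X), p ≫ f = t d p := by
  let s : Cocone (CostructuredArrow.proj j X ⋙ j) :=
    { pt := Y
      ι :=
        { app p := t p.left p.hom
          naturality p q i := by
            have h := ht i.left q.hom
            rw [CostructuredArrow.w] at h
            exact h.symm.trans (Category.comp_id _).symm } }
  exact ⟨(isColimitCostructuredArrowCocone j X).desc s, fun d p ↦
    (isColimitCostructuredArrowCocone j X).fac s (CostructuredArrow.mk p)⟩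

variable {I : Type w} [PartialOrder I] [IsDirectedOrder I] [Nonempty I] (G : I ⥤ A)

instance isFiltered_comma [∀ X, IsFiltered (CostructuredArrow j X)] : IsFiltered (Comma j G) where
  nonempty := by
    obtain ⟨i⟩ := ‹Nonempty I›
    obtain ⟨p⟩ := IsFiltered.nonempty (C := CostructuredArrow j (G.obj i))
    exact ⟨⟨p.left, i, p.hom⟩⟩
  cocone_objs x y := by
    obtain ⟨i, hx, hy⟩ := exists_ge_ge x.right y.right
    let p : CostructuredArrow j (G.obj i) := CostructuredArrow.mk (x.hom ≫ G.map (homOfLE hx))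
    let q : CostructuredArrow j (G.obj i) := CostructuredArrow.mk (y.hom ≫ G.map (homOfLE hy))
    exact ⟨⟨(IsFiltered.max p q).left, i, (IsFiltered.max p q).hom⟩,
      { left := (IsFiltered.leftToMax p q).left
        right := homOfLE hx
        w := CostructuredArrow.w (IsFiltered.leftToMax p q) },
      { left := (IsFiltered.rightToMax p q).left
        right := homOfLE hy
        w := CostructuredArrow.w (IsFiltered.rightToMax p q) }, trivial⟩
  cocone_maps x y f g := by
    let p : CostructuredArrow j (G.obj y.right) := CostructuredArrow.mk (x.hom ≫ G.map f.right)
    let q : CostructuredArrow j (G.obj y.right) := CostructuredArrow.mk y.hom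
    have hfg : f.right = g.right := Subsingleton.elim _ _
    let f' : p ⟶ q := CostructuredArrow.homMk f.left f.w
    let g' : p ⟶ q := CostructuredArrow.homMk g.left (by simp [p, q, hfg])
    refine ⟨⟨(IsFiltered.coeq f' g').left, y.right, (IsFiltered.coeq f' g').hom⟩,
      { left := (IsFiltered.coeqHom f' g').left
        right := 𝟙 _
        w := (CostructuredArrow.w (IsFiltered.coeqHom f' g')).trans (by simp [q]) }, ?_⟩
    ext
    · have h := congrArg CommaMorphism.left (IsFiltered.coeq_condition f' g')
      exact h
    · exact Subsingleton.elim _ _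

variable {G} in
/-- The cocone on the objects of `D` over a diagram given by a cocone of this diagram. -/
def commaCocone (c : Cocone G) : Cocone (Comma.fst j G ⋙ j) where
  pt := c.pt
  ι :=
    { app x := x.hom ≫ c.ι.app x.right
      naturality x y f := by
        have : j.map f.left ≫ y.hom = x.hom ≫ G.map f.right := f.w
        change j.map f.left ≫ y.hom ≫ c.ι.app y.right = (x.hom ≫ c.ι.app x.right) ≫ 𝟙 _
        rw [Category.comp_id, ← Category.assoc, this, Category.assoc, c.w] }

omit [IsDirectedOrder I] [Nonempty I] in
variable {G} in
/-- If `j` is dense, the colimit of a diagram is the colimit of the objects of `D` over it. -/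
lemma nonempty_isColimit_commaCocone [j.IsDense] {c : Cocone G} (hc : IsColimit c) :
    Nonempty (IsColimit (commaCocone j c)) := by
  have key (s : Cocone (Comma.fst j G ⋙ j)) (i : I) : ∃ m : G.obj i ⟶ s.pt,
      ∀ (d : D) (p : j.obj d ⟶ G.obj i), p ≫ m = s.ι.app (Comma.mk d i p) :=
    exists_hom_of_isDense j (fun d p ↦ s.ι.app (Comma.mk d i p)) fun d d' a p ↦
      (s.w (show Comma.mk d i (j.map a ≫ p) ⟶ Comma.mk d' i p from
        { left := a, right := 𝟙 i, w := by simp })).symm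
  choose m hm using key
  let t (s : Cocone (Comma.fst j G ⋙ j)) : Cocone G :=
    { pt := s.pt
      ι :=
        { app i := m s i
          naturality i i' a := hom_ext_of_isDense j fun d p ↦ by
            rw [← Category.assoc, hm]
            dsimp
            rw [Category.comp_id, hm]
            rw [← s.w (show Comma.mk d i p ⟶ Comma.mk d i' (p ≫ G.map a) from
              { left := 𝟙 d, right := a, w := by simp })]
            exact ((congrArg (· ≫ _) (j.map_id d)).trans (Category.id_comp _)).symm } }
  exact ⟨{
    desc := fun s ↦ hc.desc (t s)
    fac := fun s x ↦ by
      have : c.ι.app x.right ≫ hc.desc (t s) = m s x.right := hc.fac _ _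
      exact (Category.assoc _ _ _).trans ((congrArg _ this).trans (hm s _ _ _))
    uniq := fun s f hf ↦ hc.hom_ext fun i ↦ hom_ext_of_isDense j fun d p ↦ by
      have : c.ι.app i ≫ hc.desc (t s) = m s i := hc.fac _ _
      refine Eq.trans ?_ ((hm s i d p).symm.trans (congrArg (p ≫ ·) this.symm))
      rw [← hf]
      exact (Category.assoc _ _ _).symm }⟩

variable {G} in
lemma exists_factorization_colimit [HasDirectedColimits.{w} A] [j.IsDense]
    [∀ X, IsFiltered (CostructuredArrow j X)] (κ : Cardinal.{w}) [Fact κ.IsRegular]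
    {c : Cocone G} (hc : IsColimit c) {X : A} [IsCardinalPresentable X κ] (f : X ⟶ c.pt) :
    ∃ (U : Set κ.ord.ToType) (T : Finset U ⥤ D) (f' : X ⟶ colimit (T ⋙ j))
      (m : colimit (T ⋙ j) ⟶ c.pt), f' ≫ m = f ∧
      ∀ s, ∃ (i : I) (e : j.obj (T.obj s) ⟶ G.obj i),
        e ≫ c.ι.app i = colimit.ι (T ⋙ j) s ≫ m := by
  obtain ⟨hc'⟩ := nonempty_isColimit_commaCocone j hc
  -- The filtered comma category is replaced by a directed poset mapping finally to it, so that the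
  -- factorization over finite subsets applies.
  obtain ⟨P, _, _, _, F, _⟩ := IsFiltered.exists_directed (Comma j G)
  obtain ⟨U, φ, f', hf'⟩ := exists_finset_factorization (F ⋙ Comma.fst j G ⋙ j)
    ((Functor.Final.isColimitWhiskerEquiv F (commaCocone j c)).symm hc') κ f
  refine ⟨U, φ ⋙ F ⋙ Comma.fst j G, f', _, hf', fun s ↦
    ⟨(F.obj (φ.obj s)).right, (F.obj (φ.obj s)).hom, ?_⟩⟩
  exact (colimit.ι_desc (F := φ ⋙ F ⋙ Comma.fst j G ⋙ j)
    (((commaCocone j c).whisker F).whisker φ) s).symm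

end Comma

/-! ### Small subfunctors preserving directed colimits -/

section Generate

variable {A : Type u} [Category.{w} A] {D : Type w} [SmallCategory D] (j : D ⥤ A)
  (F : A ⥤ Type w)

/-- The subfunctor of `F` generated by a set of elements at objects of `D`. -/
def generate (Z : Set (Σ d : D, F.obj (j.obj d))) : Subfunctor F where
  obj a := { y | ∃ p ∈ Z, ∃ f : j.obj p.1 ⟶ a, F.map f p.2 = y }
  map {a b} i y := by
    rintro ⟨p, hp, f, rfl⟩
    exact ⟨p, hp, f ≫ i, by simp⟩

variable [HasDirectedColimits.{w} A] (κ : Cardinal.{w}) [Fact κ.IsRegular]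

/-- The morphisms from an object of `D` to the colimits of small diagrams in `D`. -/
abbrev Test (d : D) := Σ (U : Set κ.ord.ToType) (T : Finset U ⥤ D), (j.obj d ⟶ colimit (T ⋙ j))

variable {F}

/-- Elements identified in the colimit are already identified at some stage because this holds in
`F`. Closure of `Z` under tests is what makes every element of the subfunctor come from a stage. -/
lemma preservesDirectedColimits_generate [PreservesDirectedColimits.{w} F] [j.IsDense]
    [∀ X, IsFiltered (CostructuredArrow j X)] [∀ d, IsCardinalPresentable (j.obj d) κ]
    (Z : Set (Σ d : D, F.obj (j.obj d)))
    (hZ : ∀ p ∈ Z, ∀ t : Test j κ p.1, ∃ (s : Finset t.1) (z : F.obj (j.obj (t.2.1.obj s))),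
      ⟨_, z⟩ ∈ Z ∧ F.map (colimit.ι (t.2.1 ⋙ j) s) z = F.map t.2.2 p.2) :
    PreservesDirectedColimits.{w} (generate j F Z).toFunctor where
  preservesColimitsOfShape I _ _ _ := ⟨fun {G} ↦ ⟨fun {c} hc ↦ ⟨by
    have := PreservesDirectedColimits.preservesColimitsOfShape (F := F) I
    have hFc := isColimitOfPreserves F hc
    refine Types.FilteredColimit.isColimitOf' _ _ ?_ ?_
    · rintro ⟨y, p, hp, f, rfl⟩
      obtain ⟨U, T, f', m, rfl, hm⟩ := exists_factorization_colimit j κ hc f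
      obtain ⟨s, z, hz, hz'⟩ := hZ p hp ⟨U, T, f'⟩
      obtain ⟨i, e, he⟩ := hm s
      refine ⟨i, ⟨F.map e z, _, hz, e, rfl⟩, Subtype.ext ?_⟩
      change F.map (f' ≫ m) p.2 = F.map (c.ι.app i) (F.map e z)
      dsimp at hz'
      rw [← Functor.map_comp_apply, he, Functor.map_comp_apply, Functor.map_comp_apply]
      exact congrArg _ hz'.symm
    · rintro i ⟨x, hx⟩ ⟨y, hy⟩ h
      have h' : F.map (c.ι.app i) x = F.map (c.ι.app i) y := congrArg Subtype.val h
      obtain ⟨k, a, hk⟩ := (Types.FilteredColimit.isColimit_eq_iff' hFc x y).1 h'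
      exact ⟨k, a, Subtype.ext hk⟩⟩⟩⟩

lemma exists_small_subfunctor [j.IsDense]
    [∀ X, IsFiltered (CostructuredArrow j X)] [∀ d, IsCardinalPresentable (j.obj d) κ] :
    ∃ M : D → Type w, ∀ (F : A ⥤ Type w) [PreservesDirectedColimits.{w} F] (d : D)
      (x : F.obj (j.obj d)), ∃ Q : Subfunctor F, PreservesDirectedColimits.{w} Q.toFunctor ∧
        x ∈ Q.obj (j.obj d) ∧
          ∀ d', ∃ i : Q.obj (j.obj d') → M d', Function.Injective i := by
  classical
  -- An element is named by a word of tests, applied successively to `x`, and a morphism out of the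
  -- object where the resulting element lives; no such name mentions `F`.
  refine ⟨fun d' ↦ List (Σ d, Test j κ d) × Σ b : D, (j.obj b ⟶ j.obj d'), fun F _ d x ↦ ?_⟩
  have ex (p : Σ d : D, F.obj (j.obj d)) (t : Test j κ p.1) :
      ∃ q : Σ d : D, F.obj (j.obj d), ∃ (s : Finset t.1) (z : F.obj (j.obj (t.2.1.obj s))),
        q = ⟨_, z⟩ ∧ F.map (colimit.ι (t.2.1 ⋙ j) s) z = F.map t.2.2 p.2 := by
    have := PreservesDirectedColimits.preservesColimitsOfShape (F := F) (Finset t.1)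
    obtain ⟨s, z, hz⟩ := Types.jointly_surjective_of_isColimit
      (isColimitOfPreserves F (colimit.isColimit (t.2.1 ⋙ j))) (F.map t.2.2 p.2)
    exact ⟨_, s, z, rfl, hz⟩
  choose op hop using ex
  -- A test at the wrong object acts as the identity, so every word has a value.
  let step (t : Σ d, Test j κ d) (p : Σ d : D, F.obj (j.obj d)) : Σ d : D, F.obj (j.obj d) :=
    if h : t.1 = p.1 then op p (h ▸ t.2) else p
  let val (l : List (Σ d, Test j κ d)) : Σ d : D, F.obj (j.obj d) := l.foldr step ⟨d, x⟩
  refine ⟨generate j F (Set.range val), preservesDirectedColimits_generate j κ _ ?_,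
    ⟨⟨d, x⟩, ⟨[], rfl⟩, 𝟙 _, by simp⟩, fun d' ↦ ?_⟩
  · rintro _ ⟨l, rfl⟩ t
    obtain ⟨s, z, hz, h⟩ := hop (val l) t
    refine ⟨s, z, ⟨⟨_, t⟩ :: l, Eq.trans ?_ hz⟩, h⟩
    change step ⟨_, t⟩ (val l) = _
    simp [step]
  · have hy (y : (generate j F (Set.range val)).obj (j.obj d')) :
        ∃ (l : List (Σ d, Test j κ d)) (f : j.obj (val l).1 ⟶ j.obj d'),
          F.map f (val l).2 = y.1 := by
      obtain ⟨y, _, ⟨l, rfl⟩, f, hf⟩ := y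
      exact ⟨l, f, hf⟩
    choose l f hf using hy
    refine ⟨fun y ↦ ⟨l y, ⟨_, f y⟩⟩, fun y y' h ↦ Subtype.ext ?_⟩
    have key {l l' : List (Σ d, Test j κ d)} (f : j.obj (val l).1 ⟶ j.obj d')
        (f' : j.obj (val l').1 ⟶ j.obj d') (hl : l = l')
        (hf : (⟨_, f⟩ : Σ b : D, (j.obj b ⟶ j.obj d')) = ⟨_, f'⟩) :
        F.map f (val l).2 = F.map f' (val l').2 := by
      subst hl
      rw [eq_of_heq (Sigma.mk.inj hf).2]
    rw [← hf, ← hf]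
    exact key _ _ (congrArg Prod.fst h) (congrArg Prod.snd h)

end Generate
end Scott

namespace Scott

/-! ### Closure of the preserving functors under finite limits and small colimits -/

section Preservation

attribute [local instance] Cardinal.fact_isRegular_aleph0

variable {A : Type u} [Category.{v} A]

lemma preservesColimitsOfShape_of_isFiltered {B : Type u'} [Category.{v'} B] (F : A ⥤ B)
    [PreservesDirectedColimits.{w} F] (J : Type w) [SmallCategory J] [IsFiltered J] :
    PreservesColimitsOfShape J F := by
  obtain ⟨P, _, _, _, G, _⟩ := IsFiltered.exists_directed J
  have := PreservesDirectedColimits.preservesColimitsOfShape (F := F) P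
  exact Functor.Final.preservesColimitsOfShape_of_final G F

lemma preservesDirectedColimits_iff (F : A ⥤ Type w) :
    PreservesDirectedColimits.{w} F ↔ F.IsCardinalAccessible Cardinal.aleph0.{w} := by
  refine ⟨fun _ ↦ ⟨fun J _ _ ↦ ?_⟩, fun _ ↦ ⟨fun I _ _ _ ↦ ?_⟩⟩
  · have := isFiltered_of_isCardinalFiltered J Cardinal.aleph0.{w}
    exact preservesColimitsOfShape_of_isFiltered F J
  · have := (isCardinalFiltered_aleph0_iff.{w} I).2 inferInstance
    exact F.preservesColimitsOfShape_of_isCardinalAccessible Cardinal.aleph0.{w} I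

instance isClosedUnderLimitsOfShape_preservesDirectedColimits (J : Type) [SmallCategory J]
    [FinCategory J] : (preservesDirectedColimits.{w} A).IsClosedUnderLimitsOfShape J where
  limitsOfShape_le := by
    rintro F ⟨h⟩
    have (k : J) : (h.diag.obj k).IsCardinalAccessible Cardinal.aleph0.{w} :=
      (preservesDirectedColimits_iff _).1 (h.prop_diag_obj k)
    exact (preservesDirectedColimits_iff _).2 (Functor.isCardinalAccessible_of_isLimit _ h.isLimit
      Cardinal.aleph0.{w} (hasCardinalLT_of_finite _ _ le_rfl))

/-- A colimit of functors preserving a colimit preserves this colimit. -/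
lemma nonempty_isColimit_mapCocone_of_isColimit {J : Type w} [SmallCategory J]
    {F : J ⥤ A ⥤ Type w} {c : Cocone F} (hc : IsColimit c) {I : Type w} [SmallCategory I]
    {G : I ⥤ A} {s : Cocone G} (hs : ∀ k, IsColimit ((F.obj k).mapCocone s)) :
    Nonempty (IsColimit (c.pt.mapCocone s)) := by
  have hc' (a : A) := isColimitOfPreserves ((evaluation A (Type w)).obj a) hc
  let d (t : Cocone (G ⋙ c.pt)) (k : J) : Cocone (G ⋙ F.obj k) :=
    { pt := t.pt
      ι := Functor.whiskerLeft G (c.ι.app k) ≫ t.ι }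
  let e (t : Cocone (G ⋙ c.pt)) : Cocone (F ⋙ (evaluation A (Type w)).obj s.pt) :=
    { pt := t.pt
      ι :=
        { app k := (hs k).desc (d t k)
          naturality k k' f := (hs k).hom_ext fun i ↦ by
            have h₁ := (hs k).fac (d t k) i
            have h₂ := (hs k').fac (d t k') i
            have h₃ := NatTrans.congr_app (c.w f) (G.obj i)
            dsimp [d] at h₁ h₂ h₃ ⊢
            rw [Category.comp_id, h₁, (F.map f).naturality_assoc, h₂, ← Category.assoc, h₃] } }
  refine ⟨{ desc := fun t ↦ (hc' s.pt).desc (e t), fac := fun t i ↦ ?_, uniq := fun t m hm ↦ ?_ }⟩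
  · refine (hc' (G.obj i)).hom_ext fun k ↦ ?_
    have h₁ := (hs k).fac (d t k) i
    have h₂ := (hc' s.pt).fac (e t) k
    dsimp [d, e] at h₁ h₂ ⊢
    have h₃ : (F.obj k).map (s.ι.app i) ≫ (c.ι.app k).app s.pt =
        (c.ι.app k).app (G.obj i) ≫ c.pt.map (s.ι.app i) := (c.ι.app k).naturality _
    rw [← Category.assoc, ← h₃, Category.assoc, h₂, h₁]
  · refine (hc' s.pt).hom_ext fun k ↦ (hs k).hom_ext fun i ↦ ?_
    have h₁ := (hs k).fac (d t k) i
    have h₂ := (hc' s.pt).fac (e t) k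
    have h₃ := hm i
    have h₄ : (F.obj k).map (s.ι.app i) ≫ (c.ι.app k).app s.pt =
        (c.ι.app k).app (G.obj i) ≫ c.pt.map (s.ι.app i) := (c.ι.app k).naturality _
    dsimp [d, e] at h₁ h₂ h₃ ⊢
    rw [h₂, h₁, ← Category.assoc, h₄, Category.assoc, h₃]

instance isClosedUnderColimitsOfShape_preservesDirectedColimits (J : Type w) [SmallCategory J] :
    (preservesDirectedColimits.{w} A).IsClosedUnderColimitsOfShape J where
  colimitsOfShape_le := by
    rintro F ⟨h⟩
    refine ⟨fun I _ _ _ ↦ ⟨fun {G} ↦ ⟨fun {s} hs ↦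
      nonempty_isColimit_mapCocone_of_isColimit h.isColimit fun k ↦ ?_⟩⟩⟩
    have := (h.prop_diag_obj k).preservesColimitsOfShape I
    exact isColimitOfPreserves _ hs

end Preservation

/-! ### Closure properties of essential images -/

section EssImage

variable {X : Type u} [Category.{v} X] {Y : Type u'} [Category.{v'} Y] (P : ObjectProperty X)
  (W : X ⥤ Y) [(P.ι ⋙ W).Full] [(P.ι ⋙ W).Faithful]

/-- Full faithfulness makes `P` equivalent to the essential image, so whole diagrams lift, not only
their objects. -/
lemma exists_lift_of_essImage {J : Type w'} [Category.{t} J] (K : J ⥤ Y)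
    (hK : ∀ k, (P.ι ⋙ W).essImage (K.obj k)) :
    ∃ L : J ⥤ X, (∀ k, P (L.obj k)) ∧ Nonempty (L ⋙ W ≅ K) := by
  let K' : J ⥤ (P.ι ⋙ W).EssImageSubcategory := ObjectProperty.lift _ K hK
  refine ⟨K' ⋙ (P.ι ⋙ W).toEssImage.inv ⋙ P.ι, fun k ↦ ObjectProperty.FullSubcategory.property _,
    ⟨?_⟩⟩
  exact (Functor.isoWhiskerLeft (K' ⋙ (P.ι ⋙ W).toEssImage.inv)
    (P.ι ⋙ W).toEssImageCompι.symm) ≪≫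
    Functor.isoWhiskerRight (Functor.isoWhiskerLeft K'
      (P.ι ⋙ W).toEssImage.asEquivalence.counitIso) (P.ι ⋙ W).essImage.ι

lemma isClosedUnderColimitsOfShape_essImage (J : Type w') [Category.{t} J]
    [P.IsClosedUnderColimitsOfShape J] [HasColimitsOfShape J X] [PreservesColimitsOfShape J W] :
    (P.ι ⋙ W).essImage.IsClosedUnderColimitsOfShape J where
  colimitsOfShape_le := by
    rintro Q ⟨h⟩
    obtain ⟨L, hL, ⟨e⟩⟩ := exists_lift_of_essImage P W h.diag h.prop_diag_obj
    exact ⟨⟨_, P.prop_colimit L hL⟩, ⟨(isColimitOfPreserves W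
      (colimit.isColimit L)).coconePointsIsoOfNatIso h.isColimit e⟩⟩

lemma isClosedUnderLimitsOfShape_essImage (J : Type w') [Category.{t} J]
    [P.IsClosedUnderLimitsOfShape J] [HasLimitsOfShape J X] [PreservesLimitsOfShape J W] :
    (P.ι ⋙ W).essImage.IsClosedUnderLimitsOfShape J where
  limitsOfShape_le := by
    rintro Q ⟨h⟩
    obtain ⟨L, hL, ⟨e⟩⟩ := exists_lift_of_essImage P W h.diag h.prop_diag_obj
    exact ⟨⟨_, P.prop_limit L hL⟩, ⟨(isLimitOfPreserves W
      (limit.isLimit L)).conePointsIsoOfNatIso h.isLimit e⟩⟩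

end EssImage

/-! ### Full faithfulness of restriction -/

section Restriction

variable {A : Type u} [Category.{w} A] {D : Type w} [SmallCategory D] (j : D ⥤ A)
  [j.IsDense] [∀ X, IsFiltered (CostructuredArrow j X)]

/-- The restriction along `j` of functors preserving directed colimits. -/
abbrev restrictionAlong : ScottTopos.{w} A ⥤ (D ⥤ Type w) :=
  (preservesDirectedColimits.{w} A).ι ⋙ (Functor.whiskeringLeft D A (Type w)).obj j

/-- The canonical colimit presenting each object is filtered, so `F` preserves it; this is the
pointwise Kan extension formula. -/
lemma isLeftKanExtension_of_preservesDirectedColimits (F : A ⥤ Type w)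
    [PreservesDirectedColimits.{w} F] : F.IsLeftKanExtension (𝟙 (j ⋙ F)) := by
  have h : (Functor.LeftExtension.mk F (𝟙 (j ⋙ F))).IsPointwiseLeftKanExtension := fun X ↦ by
    have := preservesColimitsOfShape_of_isFiltered F (CostructuredArrow j X)
    exact IsColimit.ofIsoColimit (isColimitOfPreserves F (isColimitCostructuredArrowCocone j X))
      (Cocone.ext (Iso.refl _) fun p ↦ (Category.comp_id _).trans (Category.id_comp _).symm)
  exact h.isLeftKanExtension

lemma whiskerLeft_bijective (F : A ⥤ Type w) [PreservesDirectedColimits.{w} F] (G : A ⥤ Type w) :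
    Function.Bijective (fun τ : F ⟶ G ↦ Functor.whiskerLeft j τ) := by
  have := isLeftKanExtension_of_preservesDirectedColimits j F
  convert (F.homEquivOfIsLeftKanExtension (𝟙 (j ⋙ F)) G).bijective using 2 with τ
  exact (Category.id_comp _).symm

instance : (restrictionAlong j).Faithful where
  map_injective {F G} _ _ h := ObjectProperty.hom_ext _ (by
    have : PreservesDirectedColimits.{w} F.obj := F.property
    exact (whiskerLeft_bijective j F.obj G.obj).1 h)

instance : (restrictionAlong j).Full where
  map_surjective {F G} τ := by
    have : PreservesDirectedColimits.{w} F.obj := F.property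
    obtain ⟨σ, hσ⟩ := (whiskerLeft_bijective j F.obj G.obj).2 τ
    exact ⟨ObjectProperty.homMk σ, hσ⟩

end Restriction

/-! ### A small set of representatives for functors of bounded size -/

section Bounded

variable {D : Type w} [SmallCategory D]

/-- The data of a functor whose values are subsets of given sets. -/
def SubsetFunctor (M : D → Type w) : Type w :=
  { q : Σ S : ∀ d, Set (M d), ∀ d d' : D, (d ⟶ d') → S d → S d' //
    (∀ (d : D) (x : q.1 d), q.2 d d (𝟙 d) x = x) ∧
      ∀ (d d' d'' : D) (f : d ⟶ d') (g : d' ⟶ d'') (x : q.1 d),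
        q.2 d d'' (f ≫ g) x = q.2 d' d'' g (q.2 d d' f x) }

/-- The functor given by an element of `SubsetFunctor M`. -/
def SubsetFunctor.functor {M : D → Type w} (q : SubsetFunctor M) : D ⥤ Type w where
  obj d := q.1.1 d
  map f := ↾(q.1.2 _ _ f)
  map_id d := by
    ext x
    exact congrArg Subtype.val (q.2.1 d x)
  map_comp f g := by
    ext x
    exact congrArg Subtype.val (q.2.2 _ _ _ f g x)

lemma SubsetFunctor.exists_iso {M : D → Type w} (P : D ⥤ Type w)
    (hP : ∀ d, ∃ f : P.obj d → M d, Function.Injective f) :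
    ∃ q : SubsetFunctor M, Nonempty (q.functor ≅ P) := by
  choose f hf using hP
  let e (d : D) : P.obj d ≃ Set.range (f d) := Equiv.ofInjective _ (hf d)
  let q : SubsetFunctor M :=
    ⟨⟨fun d ↦ Set.range (f d), fun d d' i x ↦ e d' (P.map i ((e d).symm x))⟩, by simp, by simp⟩
  refine ⟨q, ⟨NatIso.ofComponents (fun d ↦ (e d).symm.toIso) fun {d d'} i ↦ ?_⟩⟩
  ext x
  exact (e d').symm_apply_apply _

end Bounded

/-! ### The topos and the right adjoint for a dense small subcategory -/

section Main

variable {A : Type u} [Category.{w} A] [HasDirectedColimits.{w} A] {D : Type w} [SmallCategory D]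
  (j : D ⥤ A) [j.IsDense] [∀ X, IsFiltered (CostructuredArrow j X)] (κ : Cardinal.{w})
  [Fact κ.IsRegular] [∀ d, IsCardinalPresentable (j.obj d) κ]

include κ in
lemma exists_isGenerating : ∃ (C : Type w) (_ : SmallCategory C) (g : C ⥤ D ⥤ Type w)
    (_ : g.Full) (_ : g.Faithful), IsGenerating (restrictionAlong j).essImage g := by
  obtain ⟨M, hM⟩ := exists_small_subfunctor j κ
  let ι : Type w := { q : SubsetFunctor M // (restrictionAlong j).essImage q.functor }
  let obj (q : ι) : D ⥤ Type w := q.1.functor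
  refine ⟨InducedCategory _ obj, inferInstance, inducedFunctor obj, inferInstance, inferInstance,
    { prop_obj := fun q ↦ q.2
      exists_app_eq := fun {F} hF d x ↦ ?_
      pullback := isClosedUnderLimitsOfShape_essImage _ _ _
      equalizer := isClosedUnderLimitsOfShape_essImage _ _ _
      colimit := fun J _ ↦ isClosedUnderColimitsOfShape_essImage _ _ _ }⟩
  obtain ⟨G, ⟨e⟩⟩ := hF
  have : PreservesDirectedColimits.{w} G.obj := G.property
  -- The bounded subfunctor through `x` restricts to a functor isomorphic to some `q` in the small
  -- family, and its inclusion is the required morphism.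
  obtain ⟨Q, hQ, hx, hQ'⟩ := hM G.obj d (e.inv.app d x)
  obtain ⟨q, ⟨ε⟩⟩ := SubsetFunctor.exists_iso (j ⋙ Q.toFunctor) hQ'
  refine ⟨(⟨q, ⟨⟨Q.toFunctor, hQ⟩, ⟨ε.symm⟩⟩⟩ : ι),
    ε.hom ≫ Functor.whiskerLeft j Q.ι ≫ e.hom, ε.inv.app d ⟨_, hx⟩, ?_⟩
  have h₁ := ConcreteCategory.congr_hom (ε.inv_hom_id_app d) ⟨_, hx⟩
  have h₂ := ConcreteCategory.congr_hom (e.inv_hom_id_app d) x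
  exact (congrArg (fun y ↦ e.hom.app d (Q.ι.app (j.obj d) y)) h₁).trans h₂

include κ in
lemma isGrothendieckTopos_and_isLeftAdjoint : IsGrothendieckTopos.{w} (ScottTopos.{w} A) ∧
    (restrictionAlong j).IsLeftAdjoint := by
  obtain ⟨C, _, g, _, _, hg⟩ := exists_isGenerating j κ
  refine ⟨?_, ?_⟩
  · obtain ⟨C', _, J, ⟨e⟩⟩ := hg.isGrothendieckTopos
    exact ⟨C', _, J, ⟨(restrictionAlong j).toEssImage.asEquivalence.trans e⟩⟩
  · have := hg.isLeftAdjoint_ι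
    exact Functor.isLeftAdjoint_of_iso (restrictionAlong j).toEssImageCompι

omit [HasDirectedColimits.{w} A] in
lemma preservesFiniteLimits_restrictionAlong {B : Type v} [Category.{v'} B] (i : B ⥤ A) :
    PreservesFiniteLimits ((preservesDirectedColimits.{w} A).ι ⋙
      (Functor.whiskeringLeft B A (Type w)).obj i) where
  preservesFiniteLimits J _ _ := by
    have : PreservesLimitsOfShape J (preservesDirectedColimits.{w} A).ι := inferInstance
    infer_instance

end Main

/-! ### Passage from the small model to the presentable objects -/

section Presentables

variable (A : Type u) [Category.{w} A] [HasDirectedColimits.{w} A] (κ : Cardinal.{w})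
  [Fact κ.IsRegular] [IsCardinalAccessibleCategory A κ]

/-- The inclusion of a small model of the category of `κ`-presentable objects. -/
noncomputable abbrev presentablesInclusion : SmallModel.{w} (Presentables A κ) ⥤ A :=
  (equivSmallModel.{w} (Presentables A κ)).inverse ⋙ (isCardinalPresentable A κ).ι

omit [HasDirectedColimits.{w} A] in
lemma isFiltered_costructuredArrow_presentablesInclusion (X : A) :
    IsFiltered (CostructuredArrow (presentablesInclusion A κ) X) := by
  have : IsFiltered (CostructuredArrow (isCardinalPresentable A κ).ι X) :=
    isFiltered_of_isCardinalFiltered _ κ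
  exact IsFiltered.of_equivalence (CostructuredArrow.pre
    (equivSmallModel.{w} (Presentables A κ)).inverse
    (isCardinalPresentable A κ).ι X).asEquivalence.symm

lemma isGrothendieckTopos_and_coreflective : IsGrothendieckTopos.{w} (ScottTopos.{w} A) ∧
    Nonempty (Coreflective (restriction.{w} A κ)) := by
  let j := presentablesInclusion A κ
  have := isFiltered_costructuredArrow_presentablesInclusion A κ
  have (d : SmallModel.{w} (Presentables A κ)) : IsCardinalPresentable (j.obj d) κ :=
    ((equivSmallModel.{w} (Presentables A κ)).inverse.obj d).property
  obtain ⟨h₁, h₂⟩ := isGrothendieckTopos_and_isLeftAdjoint j κ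
  refine ⟨h₁, ?_⟩
  let e := (equivSmallModel.{w} (Presentables A κ))
  let W := (Functor.whiskeringLeft _ _ (Type w)).obj e.functor
  -- Restriction to `A_κ` is restriction to the small model followed by an equivalence, so
  -- adjointness and full faithfulness transfer.
  let α : restrictionAlong j ⋙ W ≅ restriction A κ :=
    NatIso.ofComponents (fun F ↦ Functor.isoWhiskerRight e.unitIso.symm
      ((isCardinalPresentable A κ).ι ⋙ F.obj)) fun {F G} τ ↦ by
        ext X x
        exact (NatTrans.naturality_apply τ.hom _ x).symm
  have := Functor.isLeftAdjoint_of_iso α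
  have := Functor.Full.of_iso α
  have := Functor.Faithful.of_iso α
  exact ⟨⟨_, Adjunction.ofIsLeftAdjoint (restriction A κ)⟩⟩

end Presentables

end Scott

theorem mainTheorem10 (A : Type u) [Category.{w} A]
    [IsAccessibleCategory.{w} A] [Scott.HasDirectedColimits.{w} A] :
    Scott.IsGrothendieckTopos.{w} (Scott.ScottTopos.{w} A) ∧
    ∀ (κ : Cardinal.{w}) [Fact κ.IsRegular] [IsCardinalAccessibleCategory A κ],
      Nonempty (Coreflective (Scott.restriction A κ)) ∧
      ∀ (R : (Scott.Presentables A κ ⥤ Type w) ⥤ Scott.ScottTopos.{w} A)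
        (adj : Scott.restriction A κ ⊣ R),
        PreservesFiniteLimits adj.toComonad.toFunctor := by
  obtain ⟨κ₀, _, _⟩ := IsAccessibleCategory.exists_cardinal.{w} A
  refine ⟨(Scott.isGrothendieckTopos_and_coreflective A κ₀).1, fun κ _ _ ↦
    ⟨(Scott.isGrothendieckTopos_and_coreflective A κ).2, fun R adj ↦ ?_⟩⟩
  have : PreservesFiniteLimits (Scott.restriction A κ) :=
    Scott.preservesFiniteLimits_restrictionAlong (isCardinalPresentable A κ).ι
  have := adj.rightAdjoint_preservesLimits
  exact comp_preservesFiniteLimits R (Scott.restriction A κ)
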